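/- **Setting.** Fix $d,m\in\mathbb N$, a continuously differentiable function $\mu:\mathbb R\to\mathbb R$ with $\mu'>0$, and $\phi>0$. Consider a sequence of finite populations $U=\{1,\dots,N\}$ and samples of size $n$, where $N$ and $n$ vary along the sequence and $n\to\infty$. Unit $i$ has non-stochastic covariates $\mathbf x_{ij}\in\mathbb R^d$ ($1\le j\le m$), an invertible working correlation matrix $\mathbf R_i$ ($m\times m$), and a random response vector $\mathbf y_i\in\mathbb R^m$. All these may depend on the population, and all responses are defined on one probability space $(\Theta,\mathcal A,P_{\beta_0})$, the model. Given design variables, which are random elements on $\Theta$, a sample $s\subset U$ with $|s|=n$ is selected according to a probability sampling design $P_\pi$, independently of everything else in the model. Let $P_{\beta_0,\pi}$ be the resulting joint law of population and sample, $\pi_i=P_\pi(i\in s)$ and $w_i=\pi_i^{-1}$. Put $\boldsymbol\mu_i(\beta)=(\mu(\mathbf x_{ij}^T\beta))_{j}$, $\mathbf A_i(\beta)=\mathrm{diag}\{\phi\,\mu'(\mathbf x_{ij}^T\beta)\}_{j}$ and $$\mathbf g_i(\beta)=\Big[\tfrac{\partial\boldsymbol\mu_i(\beta)}{\partial\beta^T}\Big]^T\mathbf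 A_i(\beta)^{-1/2}\mathbf R_i^{-1}\mathbf A_i(\beta)^{-1/2}[\mathbf y_i-\boldsymbol\mu_i(\beta)],$$ $$\bar{\mathbf g}_N(\beta)=\frac1N\sum_{i=1}^N\mathbf g_i(\beta),\qquad \mathbf g_n(\beta)=\frac1N\sum_{i\in s}w_i\,\mathbf g_i(\beta),\qquad \nabla\mathbf g_n(\beta)=-\frac{\partial\mathbf g_n(\beta)}{\partial\beta^T}.$$ Let $\beta_0$ be an interior point of $\Omega\subset\mathbb R^d$, and $\mathcal B_n(r)=\{\beta\in\Omega:\ \sqrt n\,\|\beta-\beta_0\|\le r\}$ for $r>0$. **Assumptions.** * $(N_0)$ $n/N\to f$ with $0\le f<1$. * $(G_1)$ $\sqrt N\,\bar{\mathbf g}_N(\beta_0)\to\mathcal N(0,\Sigma^g_{\beta_0})$ in distribution under $P_{\beta_0}$, where $\Sigma^g_{\beta_0}$ is positive definite. * $(G_2)$ For $P_{\beta_0}$-almost every realization of the sequence of populations, $\sqrt n\,[\mathbf g_n(\beta_0)-\bar{\mathbf g}_N(\beta_0)]\to\mathcal N(0,\Sigma^g_d)$ in distribution under $P_\pi$, where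 $\Sigma^g_d$ is positive definite and non-stochastic. * $(G_3)$ There is an invertible non-stochastic $d\times d$ matrix $D_0$ such that, for every $r>0$, $\mathbf g_n$ is differentiable at every point of $\mathcal B_n(r)$ with $P_{\beta_0,\pi}$-probability tending to one, and $\sup_{\beta\in\mathcal B_n(r)}\|\nabla\mathbf g_n(\beta)-D_0\|\to0$ in $P_{\beta_0,\pi}$-probability (operator norm). * $\bar\beta_n$ is a sequence of survey-weighted GEE estimators: random vectors such that, with $P_{\beta_0,\pi}$-probability tending to one, $\bar\beta_n\in\Omega$ and $\mathbf g_n(\bar\beta_n)=0$. Moreover, either $\sqrt n\,\|\bar\beta_n-\beta_0\|=O_{P_{\beta_0,\pi}}(1)$, or there is a fixed neighbourhood $V$ of $\beta_0$ (possibly $V\supset\Omega$) such that, with probability tending to one, $\bar\beta_n\in V$ and $\mathbf g_n$ has no other zero in $V\cap\Omega$. **Conclusion.** Under $P_{\beta_0,\pi}$, $$\sqrt n\,(\bar\beta_n-\beta_0)\to\mathcal N\big(0,\ D_0^{-1}\,\Sigma^g_0\,(D_0^{-1})^T\big)\ \text{ in distribution},\qquad \Sigma^g_0=\Sigma^g_d+f\,\Sigma^g_{\beta_0}.$$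 In particular the limiting covariance matrix is $D_0^{-1}\Sigma_0^gD_0^{-1}$ when $D_0$ is symmetric. -/

import Mathlib

open MeasureTheory ProbabilityTheory Filter Topology
open scoped ENNReal

/-- A statement holds with probability tending to one along a sequence of probability spaces
(the complement may be non-measurable, its outer measure is used). -/
def WithProbTendingToOne {Ω : ℕ → Type*} [∀ ν, MeasurableSpace (Ω ν)]
    (J : ∀ ν, Measure (Ω ν)) (A : ∀ ν, Ω ν → Prop) : Prop :=
  Tendsto (fun ν => J ν {ω | ¬ A ν ω}) atTop (𝓝 0)

/-- Convergence to zero in probability of nonnegative, possibly infinite, quantities along a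
sequence of probability spaces. -/
def TendstoZeroInProb {Ω : ℕ → Type*} [∀ ν, MeasurableSpace (Ω ν)]
    (J : ∀ ν, Measure (Ω ν)) (X : ∀ ν, Ω ν → ℝ≥0∞) : Prop :=
  ∀ ε : ℝ≥0∞, 0 < ε → Tendsto (fun ν => J ν {ω | ε < X ν ω}) atTop (𝓝 0)

/-- The sequence `X ν` is `O_P(1)` along a sequence of probability spaces. -/
def BoundedInProb {Ω : ℕ → Type*} [∀ ν, MeasurableSpace (Ω ν)]
    (J : ∀ ν, Measure (Ω ν)) (X : ∀ ν, Ω ν → ℝ) : Prop :=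
  ∀ ε : ℝ≥0∞, 0 < ε → ∃ r : ℝ, ∀ᶠ ν in atTop, J ν {ω | r < X ν ω} ≤ ε

namespace GEE

/-- The Jacobian matrix `∂F/∂βᵀ`, whose entry `(j, k)` is `∂F_j/∂β_k`. -/
noncomputable def jacobian {d q : ℕ} (F : EuclideanSpace ℝ (Fin d) → EuclideanSpace ℝ (Fin q))
    (β : EuclideanSpace ℝ (Fin d)) : Matrix (Fin q) (Fin d) ℝ :=
  Matrix.of fun j k => fderiv ℝ F β (EuclideanSpace.single k 1) j

/-- Marginal mean vector of one unit: `μ_j(β) = μ(x_jᵀ β)`. -/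
noncomputable def meanVec {d m : ℕ} (μ : ℝ → ℝ) (x : Fin m → EuclideanSpace ℝ (Fin d))
    (β : EuclideanSpace ℝ (Fin d)) : EuclideanSpace ℝ (Fin m) :=
  WithLp.toLp 2 fun j => μ (inner ℝ (x j) β)

/-- The matrix `A(β)^{-1/2}`, where `A(β) = diag(φ μ'(x_jᵀ β))` is the diagonal matrix of
marginal variances. -/
noncomputable def invSqrtVar {d m : ℕ} (μ : ℝ → ℝ) (φ : ℝ)
    (x : Fin m → EuclideanSpace ℝ (Fin d)) (β : EuclideanSpace ℝ (Fin d)) :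
    Matrix (Fin m) (Fin m) ℝ :=
  Matrix.diagonal fun j => (Real.sqrt (φ * deriv μ (inner ℝ (x j) β)))⁻¹

/-- Contribution of one unit to the generalized estimating function:
`(∂μ/∂βᵀ)ᵀ A(β)^{-1/2} R⁻¹ A(β)^{-1/2} (y - μ(β))`. -/
noncomputable def score {d m : ℕ} (μ : ℝ → ℝ) (φ : ℝ) (R : Matrix (Fin m) (Fin m) ℝ)
    (x : Fin m → EuclideanSpace ℝ (Fin d)) (y : EuclideanSpace ℝ (Fin m))
    (β : EuclideanSpace ℝ (Fin d)) : EuclideanSpace ℝ (Fin d) :=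
  WithLp.toLp 2 (((jacobian (meanVec μ x) β).transpose * invSqrtVar μ φ x β * R⁻¹ *
    invSqrtVar μ φ x β).mulVec (y - meanVec μ x β).ofLp)

/-- A sequence, indexed by `ν`, of finite populations of longitudinal responses, all defined on
one super-population space `Θ`, with sampling designs. -/
structure SurveySequence (Θ : Type*) [MeasurableSpace Θ] (d m : ℕ) where
  /-- the link function -/
  μ : ℝ → ℝ
  μ_contDiff : ContDiff ℝ 1 μ
  μ_deriv_pos : ∀ t, 0 < deriv μ t
  /-- the over-dispersion parameter -/
  φ : ℝ
  φ_pos : 0 < φ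
  /-- population size -/
  N : ℕ → ℕ
  /-- sample size -/
  n : ℕ → ℕ
  /-- non-stochastic covariates of the units -/
  x : ∀ ν, Fin (N ν) → Fin m → EuclideanSpace ℝ (Fin d)
  /-- working correlation matrices, at the given value of the nuisance parameter -/
  R : ∀ ν, Fin (N ν) → Matrix (Fin m) (Fin m) ℝ
  R_isUnit : ∀ ν i, IsUnit (R ν i)
  /-- response vectors of the units -/
  y : ∀ ν, Fin (N ν) → Θ → EuclideanSpace ℝ (Fin m)
  y_measurable : ∀ ν i, Measurable (y ν i)
  /-- the space of values of the design variables -/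
  DesignSpace : ℕ → Type*
  [designSpace_measurable : ∀ ν, MeasurableSpace (DesignSpace ν)]
  /-- the design variables -/
  z : ∀ ν, Θ → DesignSpace ν
  z_measurable : ∀ ν, Measurable (z ν)
  /-- the sampling design: the law of the selected sample, given the design variables -/
  design : ∀ ν, Kernel (DesignSpace ν) (Finset (Fin (N ν)))
  [design_markov : ∀ ν, IsMarkovKernel (design ν)]
  design_card : ∀ ν v, ∀ᵐ s ∂(design ν v), s.card = n ν

attribute [instance] SurveySequence.designSpace_measurable SurveySequence.design_markov

namespace SurveySequence

variable {Θ : Type*} [MeasurableSpace Θ] {d m : ℕ} (S : SurveySequence Θ d m)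

/-- The design probability `P_π` of the `ν`-th survey, given the realized population `θ`. -/
noncomputable def designProb (ν : ℕ) (θ : Θ) : Measure (Finset (Fin (S.N ν))) :=
  S.design ν (S.z ν θ)

instance (ν : ℕ) (θ : Θ) : IsProbabilityMeasure (S.designProb ν θ) := by
  unfold designProb; infer_instance

/-- The joint model-design probability on populations and samples: given the design variables,
the sample is selected by the design, independently of everything else in the model. -/
noncomputable def jointProb (P : Measure Θ) (ν : ℕ) : Measure (Θ × Finset (Fin (S.N ν))) :=
  P ⊗ₘ ((S.design ν).comap (S.z ν) (S.z_measurable ν))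

instance (P : Measure Θ) [IsProbabilityMeasure P] (ν : ℕ) :
    IsProbabilityMeasure (S.jointProb P ν) := by
  unfold jointProb; infer_instance

/-- First-order inclusion probability `π_i = P_π(i ∈ s)`. -/
noncomputable def inclusionProb (ν : ℕ) (θ : Θ) (i : Fin (S.N ν)) : ℝ :=
  (S.designProb ν θ).real {s | i ∈ s}

/-- Census estimating function `ḡ_N(β)`: the population mean of the individual scores. -/
noncomputable def census (ν : ℕ) (θ : Θ) (β : EuclideanSpace ℝ (Fin d)) :
    EuclideanSpace ℝ (Fin d) :=
  (S.N ν : ℝ)⁻¹ • ∑ i, score S.μ S.φ (S.R ν i) (S.x ν i) (S.y ν i θ) β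

/-- Survey-weighted estimating function, with design weights `w_i = π_i⁻¹`:
`N⁻¹ ∑_{i ∈ s} w_i (score of unit i)`. -/
noncomputable def wgee (ν : ℕ) (ω : Θ × Finset (Fin (S.N ν))) (β : EuclideanSpace ℝ (Fin d)) :
    EuclideanSpace ℝ (Fin d) :=
  (S.N ν : ℝ)⁻¹ • ∑ i ∈ ω.2, (S.inclusionProb ν ω.1 i)⁻¹ •
    score S.μ S.φ (S.R ν i) (S.x ν i) (S.y ν i ω.1) β

/-- The negative Jacobian `∇g = -∂g/∂βᵀ` of the survey-weighted estimating function. -/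
noncomputable def negJacobian (ν : ℕ) (ω : Θ × Finset (Fin (S.N ν)))
    (β : EuclideanSpace ℝ (Fin d)) : Matrix (Fin d) (Fin d) ℝ :=
  -jacobian (S.wgee ν ω) β

/-- The shrinking neighbourhood `{β ∈ B : √n ‖β - β₀‖ ≤ r}` of `β₀` in the parameter set `B`. -/
def localBall (B : Set (EuclideanSpace ℝ (Fin d))) (β₀ : EuclideanSpace ℝ (Fin d))
    (r : ℝ) (ν : ℕ) : Set (EuclideanSpace ℝ (Fin d)) :=
  {β ∈ B | Real.sqrt (S.n ν) * ‖β - β₀‖ ≤ r}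

/-- `βbar` is a sequence of survey-weighted GEE estimators of `β₀`: random vectors which solve the
survey-weighted GEE with probability tending to one, and either are `√n`-consistent or are,
with probability tending to one, the only solution in some fixed neighbourhood of `β₀`
(possibly in the whole parameter set). -/
structure IsEstimator (P : Measure Θ) (B : Set (EuclideanSpace ℝ (Fin d)))
    (β₀ : EuclideanSpace ℝ (Fin d))
    (βbar : ∀ ν, Θ × Finset (Fin (S.N ν)) → EuclideanSpace ℝ (Fin d)) : Prop where
  aemeasurable : ∀ ν, AEMeasurable (βbar ν) (S.jointProb P ν)
  root : WithProbTendingToOne (S.jointProb P) fun ν ω =>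
    βbar ν ω ∈ B ∧ S.wgee ν ω (βbar ν ω) = 0
  selection :
    BoundedInProb (S.jointProb P) (fun ν ω => Real.sqrt (S.n ν) * ‖βbar ν ω - β₀‖) ∨
    ∃ V ∈ 𝓝 β₀, WithProbTendingToOne (S.jointProb P) fun ν ω =>
      βbar ν ω ∈ V ∧ ∀ β ∈ V ∩ B, S.wgee ν ω β = 0 → β = βbar ν ω

end SurveySequence

end GEE

/-! On balls of radius of order `n^(-1/2)` around `β₀`, the function `g_n` is close to affine with
linear part `-D₀`, by the mean value inequality. A zero `β̄` in such a ball therefore satisfies `√n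
(β̄ - β₀) ≈ D₀⁻¹ √n g_n(β₀)` (`norm_sub_inv_le_of_approximatesLinearOn`), and Slutsky's lemma
reduces the theorem to a central limit theorem for `√n g_n(β₀)`.

That variable is `√n ḡ_N(β₀)`, a function of the population alone, plus the design error. Given the
population, the design error has a limit law that does not depend on the population. Its conditional
characteristic function may thus be replaced by a constant, and the joint one factorizes in the
limit (`tendstoInDistribution_add_of_conditional`). The factor `√(n/N) → √f` yields the term `f •
Sigβ`.

If `√n`-consistency is not assumed, a quantitative surjectivity argument
(`exists_zero_of_approximatesLinearOn`) gives a zero within `O(n^(-1/2))` of `β₀`, and local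
uniqueness identifies it with `β̄`. -/

section ConvergenceInDistribution

/-! ### Slutsky's lemma and tightness over varying probability spaces. -/

variable {E : Type*} [NormedAddCommGroup E] [MeasurableSpace E] [BorelSpace E]

/-- **Slutsky's lemma** for random vectors defined on varying probability spaces: a sequence at
vanishing distance in probability of a sequence converging in distribution has the same limit. -/
theorem MeasureTheory.TendstoInDistribution.of_norm_sub_tendsto_zero [SecondCountableTopology E]
    {Ω : ℕ → Type*} {Ω' : Type*} {mΩ : ∀ ν, MeasurableSpace (Ω ν)} {mΩ' : MeasurableSpace Ω'}
    {J : ∀ ν, Measure (Ω ν)} [∀ ν, IsProbabilityMeasure (J ν)] {ρ : Measure Ω'}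
    [IsProbabilityMeasure ρ] {X Y : ∀ ν, Ω ν → E} {Z : Ω' → E}
    (hX : TendstoInDistribution X atTop Z J ρ) (hY : ∀ ν, AEMeasurable (Y ν) (J ν))
    (hXY : ∀ ε : ℝ, 0 < ε →
      Tendsto (fun ν => J ν {ω | ε ≤ ‖Y ν ω - X ν ω‖}) atTop (𝓝 0)) :
    TendstoInDistribution Y atTop Z J ρ := by
  -- Hypotheses and conclusion involve only the joint law of `(X ν, Y ν)` for each `ν` separately,
  -- so any coupling across `ν` will do. On the product space, with index `ν` reading coordinate
  -- `ν`, the one-space version of the lemma applies.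
  have hev (ν : ℕ) := measurePreserving_eval_infinitePi J ν
  have map_eq (W : ∀ ν, Ω ν → E) (hW : ∀ ν, AEMeasurable (W ν) (J ν)) (ν : ℕ) :
      (Measure.infinitePi J).map (fun ω => W ν (ω ν)) = (J ν).map (W ν) := by
    have h := AEMeasurable.map_map_of_aemeasurable (μ := Measure.infinitePi J)
      (f := Function.eval ν) (g := W ν) (by rw [(hev ν).map_eq]; exact hW ν)
      (hev ν).measurable.aemeasurable
    rw [(hev ν).map_eq] at h
    exact h.symm
  have hX' := hX.forall_aemeasurable
  have key : TendstoInDistribution (fun ν (ω : ∀ ν, Ω ν) => Y ν (ω ν)) atTop Z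
      (fun _ => Measure.infinitePi J) ρ := by
    refine tendstoInDistribution_of_tendstoInMeasure_sub
      (X := fun ν (ω : ∀ ν, Ω ν) => X ν (ω ν)) _ Z ⟨fun ν =>
        (hX' ν).comp_quasiMeasurePreserving (hev ν).quasiMeasurePreserving,
        hX.aemeasurable_limit, ?_⟩ ?_ fun ν =>
        (hY ν).comp_quasiMeasurePreserving (hev ν).quasiMeasurePreserving
    · have h := hX.tendsto
      simp_rw [map_eq X hX']
      exact h
    · rw [tendstoInMeasure_iff_norm]
      intro ε hε
      refine (hXY ε hε).congr fun ν => ?_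
      have hm : NullMeasurableSet {ω | ε ≤ ‖Y ν ω - X ν ω‖} (J ν) :=
        nullMeasurableSet_le aemeasurable_const ((hY ν).sub (hX' ν)).norm
      rw [← (hev ν).measure_preimage hm]
      simp [Function.eval]
  refine ⟨hY, hX.aemeasurable_limit, ?_⟩
  have h := key.tendsto
  simp_rw [map_eq Y hY] at h
  exact h

/-- A sequence converging in distribution is bounded in probability. -/
theorem MeasureTheory.TendstoInDistribution.eventually_measure_norm_ge_le [ProperSpace E]
    {Ω : ℕ → Type*} {Ω' : Type*} {mΩ : ∀ ν, MeasurableSpace (Ω ν)} {mΩ' : MeasurableSpace Ω'}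
    {J : ∀ ν, Measure (Ω ν)} [∀ ν, IsProbabilityMeasure (J ν)] {ρ : Measure Ω'}
    [IsProbabilityMeasure ρ] {X : ∀ ν, Ω ν → E} {Z : Ω' → E}
    (hX : TendstoInDistribution X atTop Z J ρ) {ε : ℝ≥0∞} (hε : 0 < ε) :
    ∃ M : ℝ, 0 < M ∧ ∀ᶠ ν in atTop, J ν {ω | M ≤ ‖X ν ω‖} ≤ ε := by
  have := Measure.isProbabilityMeasure_map hX.aemeasurable_limit
  have htight := isTightMeasureSet_iff_tendsto_measure_norm_gt.1
    (isTightMeasureSet_singleton (μ := ρ.map Z))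
  simp only [Set.mem_singleton_iff, iSup_iSup_eq_left] at htight
  obtain ⟨M, hM, hM0⟩ := ((htight.eventually_lt_const hε).and (eventually_ge_atTop 0)).exists
  -- The portmanteau bound on the limsup needs a closed set, whereas tightness controls the open
  -- tail `M < ‖x‖`; passing to `M + 1` puts a closed tail inside it.
  have hclosed : IsClosed {x : E | M + 1 ≤ ‖x‖} := isClosed_le continuous_const continuous_norm
  have hlim := ProbabilityMeasure.limsup_measure_closed_le_of_tendsto hX.tendsto hclosed
  have hlt : (ρ.map Z) {x : E | M + 1 ≤ ‖x‖} < ε :=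
    (measure_mono fun x (hx : M + 1 ≤ ‖x‖) => by
      change M < ‖x‖; linarith).trans_lt hM
  refine ⟨M + 1, by linarith, ?_⟩
  filter_upwards [eventually_lt_of_limsup_lt (hlim.trans_lt hlt)] with ν hν
  rw [ProbabilityMeasure.coe_mk,
    Measure.map_apply_of_aemeasurable (hX.forall_aemeasurable ν) hclosed.measurableSet] at hν
  exact hν.le

end ConvergenceInDistribution

/-! ### Adding a conditional limit to an unconditional one. -/

section ConditionalLimit

variable {E : Type*} [NormedAddCommGroup E] [InnerProductSpace ℝ E] [FiniteDimensional ℝ E]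
  [MeasurableSpace E] [BorelSpace E]

theorem MeasureTheory.charFun_map_eq_integral {α : Type*} [MeasurableSpace α] (m : Measure α)
    {W : α → E} (hW : Measurable W) (t : E) :
    charFun (m.map W) t = ∫ a, Complex.exp ((inner ℝ (W a) t : ℝ) * Complex.I) ∂m := by
  rw [charFun_apply, integral_map hW.aemeasurable (by fun_prop)]

/-- If `U ν` converges in distribution to `ρ₁` and, conditionally on almost every `θ`, `T ν (θ, ·)`
converges in distribution to a law `ρ₂` which does not depend on `θ`, then the sum converges in
distribution to `ρ₁ ∗ ρ₂`. -/
theorem tendstoInDistribution_add_of_conditional {Θ : Type*} [MeasurableSpace Θ] {P : Measure Θ}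
    [IsProbabilityMeasure P] {A : ℕ → Type*} [∀ ν, MeasurableSpace (A ν)]
    (κ : ∀ ν, Kernel Θ (A ν)) [∀ ν, IsMarkovKernel (κ ν)] {U : ℕ → Θ → E}
    (hU : ∀ ν, Measurable (U ν)) {T : ∀ ν, Θ × A ν → E} (hT : ∀ ν, Measurable (T ν))
    {ρ₁ ρ₂ : Measure E} [IsProbabilityMeasure ρ₁] [IsProbabilityMeasure ρ₂]
    (hlimU : TendstoInDistribution U atTop id (fun _ => P) ρ₁)
    (hlimT : ∀ᵐ θ ∂P, TendstoInDistribution (fun ν s => T ν (θ, s)) atTop id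
      (fun ν => κ ν θ) ρ₂) :
    TendstoInDistribution (fun ν ω => U ν ω.1 + T ν ω) atTop id (fun ν => P ⊗ₘ κ ν)
      (ρ₁ ∗ ρ₂) := by
  have hUT (ν : ℕ) : Measurable fun ω : Θ × A ν => U ν ω.1 + T ν ω :=
    ((hU ν).comp measurable_fst).add (hT ν)
  refine ⟨fun ν => (hUT ν).aemeasurable, aemeasurable_id, ?_⟩
  refine ProbabilityMeasure.tendsto_iff_tendsto_charFun.2 fun t => ?_
  have hUc := ProbabilityMeasure.tendsto_iff_tendsto_charFun.1 hlimU.tendsto t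
  have hTc : ∀ᵐ θ ∂P, Tendsto (fun ν => charFun ((κ ν θ).map fun s => T ν (θ, s)) t) atTop
      (𝓝 (charFun ρ₂ t)) := by
    filter_upwards [hlimT] with θ hθ
    simpa using ProbabilityMeasure.tendsto_iff_tendsto_charFun.1 hθ.tendsto t
  simp only [ProbabilityMeasure.coe_mk, Measure.map_id] at hUc ⊢
  rw [charFun_conv]
  let e : E → ℂ := fun x => Complex.exp ((inner ℝ x t : ℝ) * Complex.I)
  have he : Continuous e := by fun_prop
  have hen (x : E) : ‖e x‖ = 1 := Complex.norm_exp_ofReal_mul_I _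
  -- The characteristic function at `t` of `T ν` conditional on `θ`; it converges almost surely to a
  -- constant.
  let φ : ℕ → Θ → ℂ := fun ν θ => ∫ s, e (T ν (θ, s)) ∂κ ν θ
  have hφm (ν : ℕ) : StronglyMeasurable (φ ν) :=
    ((he.measurable.comp (hT ν)).stronglyMeasurable).integral_kernel_prod_right'
  have hφn (ν : ℕ) (θ : Θ) : ‖φ ν θ‖ ≤ 1 := by
    refine (norm_integral_le_integral_norm _).trans ?_
    simp [hen]
  have hψn : ‖charFun ρ₂ t‖ ≤ 1 := norm_charFun_le_one t
  have hφ : ∀ᵐ θ ∂P, Tendsto (fun ν => φ ν θ) atTop (𝓝 (charFun ρ₂ t)) := by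
    filter_upwards [hTc] with θ hθ
    refine hθ.congr fun ν => ?_
    exact charFun_map_eq_integral _ ((hT ν).comp measurable_prodMk_left) t
  have heU (ν : ℕ) : Measurable fun θ => e (U ν θ) := he.measurable.comp (hU ν)
  have hjoint (ν : ℕ) : charFun ((P ⊗ₘ κ ν).map fun ω => U ν ω.1 + T ν ω) t
      = ∫ θ, e (U ν θ) * φ ν θ ∂P := by
    rw [charFun_map_eq_integral _ (hUT ν), Measure.integral_compProd]
    · refine integral_congr_ae (ae_of_all _ fun θ => ?_)
      simp only [φ]
      rw [← integral_const_mul]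
      refine integral_congr_ae (ae_of_all _ fun s => ?_)
      simp only [e]
      rw [← Complex.exp_add, inner_add_left]
      push_cast
      ring_nf
    · exact Integrable.of_bound (he.measurable.comp (hUT ν)).aestronglyMeasurable 1
        (ae_of_all _ fun ω => (hen _).le)
  -- The factor `e (U ν θ)` need not converge pointwise, but it has modulus one. Dominated
  -- convergence with bound `2` therefore replaces `φ ν` by its limit, leaving the characteristic
  -- function of `U ν` times a constant.
  have hdiff : Tendsto (fun ν => ∫ θ, e (U ν θ) * (φ ν θ - charFun ρ₂ t) ∂P) atTop (𝓝 0) := by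
    have h := tendsto_integral_of_dominated_convergence (μ := P)
      (F := fun ν θ => e (U ν θ) * (φ ν θ - charFun ρ₂ t)) (f := fun _ => 0) (fun _ => 2)
      (fun ν => ((heU ν).stronglyMeasurable.mul
        ((hφm ν).sub stronglyMeasurable_const)).aestronglyMeasurable)
      (integrable_const _) (fun ν => ae_of_all _ fun θ => ?_) ?_
    · simpa using h
    · rw [norm_mul, hen, one_mul]
      exact (norm_sub_le _ _).trans (by linarith [hφn ν θ])
    · filter_upwards [hφ] with θ hθ
      rw [tendsto_zero_iff_norm_tendsto_zero]
      simp only [norm_mul, hen, one_mul]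
      simpa using (hθ.sub_const (charFun ρ₂ t)).norm
  have hsum := hdiff.add (hUc.mul_const (charFun ρ₂ t))
  rw [zero_add] at hsum
  refine hsum.congr fun ν => ?_
  rw [hjoint, charFun_map_eq_integral _ (hU ν), ← integral_mul_const, ← integral_add]
  · exact integral_congr_ae (ae_of_all _ fun θ => by simp only []; ring)
  · refine Integrable.of_bound ((heU ν).stronglyMeasurable.mul
      ((hφm ν).sub stronglyMeasurable_const)).aestronglyMeasurable 2 (ae_of_all _ fun θ => ?_)
    rw [norm_mul, hen, one_mul]
    exact (norm_sub_le _ _).trans (by linarith [hφn ν θ])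
  · exact Integrable.of_bound ((heU ν).mul_const _).aestronglyMeasurable 1
      (ae_of_all _ fun θ => by rw [norm_mul, hen, one_mul]; exact hψn)

end ConditionalLimit

/-! ### Linear images and convolutions of centred Gaussian laws. -/

section Gaussian

variable {ι : Type*} [Fintype ι] [DecidableEq ι]

open scoped Matrix

/-- The image of a centred Gaussian law under a linear map. -/
theorem ProbabilityTheory.multivariateGaussian_map_toEuclideanCLM {S : Matrix ι ι ℝ}
    (hS : S.PosSemidef) (M : Matrix ι ι ℝ) :
    (multivariateGaussian 0 S).map (Matrix.toEuclideanCLM (n := ι) (𝕜 := ℝ) M) =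
      multivariateGaussian 0 (M * S * Mᵀ) := by
  have hMS : (M * S * Mᵀ).PosSemidef := by
    simpa [Matrix.conjTranspose_eq_transpose_of_trivial] using hS.mul_mul_conjTranspose_same M
  apply Measure.ext_of_charFun (E := EuclideanSpace ℝ ι)
  ext t
  -- The transpose moves `M` onto the test vector, and the quadratic form of `S` at `Mᵀ t` is that
  -- of `M * S * Mᵀ` at `t`.
  have hadj (x : EuclideanSpace ℝ ι) : inner ℝ (Matrix.toEuclideanCLM (n := ι) (𝕜 := ℝ) M x) t =
      inner ℝ x (Matrix.toEuclideanCLM (n := ι) (𝕜 := ℝ) Mᵀ t) := by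
    rw [real_inner_comm, Matrix.inner_toEuclideanCLM, Matrix.inner_toEuclideanCLM,
      Matrix.dotProduct_mulVec, ← Matrix.mulVec_transpose, dotProduct_comm]
  rw [charFun_apply, integral_map (by fun_prop) (by fun_prop)]
  simp_rw [hadj]
  rw [← charFun_apply, charFun_multivariateGaussian hS, charFun_multivariateGaussian hMS]
  congr 3
  simp only [inner_zero_right]
  rw [← Matrix.mulVec_mulVec, ← Matrix.mulVec_mulVec, Matrix.dotProduct_mulVec t.ofLp M,
    ← Matrix.mulVec_transpose]
  rfl

/-- The convolution of a centred Gaussian law with a scaled one. -/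
theorem ProbabilityTheory.multivariateGaussian_map_smul_conv {S₁ S₂ : Matrix ι ι ℝ}
    (h₁ : S₁.PosSemidef) (h₂ : S₂.PosSemidef) (c : ℝ) :
    ((multivariateGaussian 0 S₁).map fun x => c • x) ∗ multivariateGaussian 0 S₂ =
      multivariateGaussian 0 (S₂ + (c ^ 2) • S₁) := by
  have : IsProbabilityMeasure ((multivariateGaussian 0 S₁).map fun x => c • x) :=
    Measure.isProbabilityMeasure_map (by fun_prop)
  apply Measure.ext_of_charFun (E := EuclideanSpace ℝ ι)
  ext t
  rw [charFun_conv, charFun_map_smul, charFun_multivariateGaussian h₁,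
    charFun_multivariateGaussian h₂,
    charFun_multivariateGaussian (h₂.add (h₁.smul (sq_nonneg c))), ← Complex.exp_add]
  congr 1
  simp [Matrix.mulVec_smul, Matrix.add_mulVec, Matrix.smul_mulVec]
  ring

end Gaussian

/-! ### Calculus of events with probability tending to one. -/

section ConvergenceInProbability

variable {Ω : ℕ → Type*} [∀ ν, MeasurableSpace (Ω ν)] {J : ∀ ν, Measure (Ω ν)}
  {A A' : ∀ ν, Ω ν → Prop}

theorem WithProbTendingToOne.mono (h : WithProbTendingToOne J A)
    (hAA' : ∀ᶠ ν in atTop, ∀ ω, A ν ω → A' ν ω) : WithProbTendingToOne J A' := by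
  refine tendsto_of_tendsto_of_tendsto_of_le_of_le' tendsto_const_nhds h
    (Eventually.of_forall fun _ => zero_le) ?_
  filter_upwards [hAA'] with ν hν
  exact measure_mono fun ω hω hA => hω (hν ω hA)

theorem WithProbTendingToOne.and (h : WithProbTendingToOne J A)
    (h' : WithProbTendingToOne J A') : WithProbTendingToOne J fun ν ω => A ν ω ∧ A' ν ω := by
  have hsum := Tendsto.add h h'
  rw [add_zero] at hsum
  refine tendsto_of_tendsto_of_tendsto_of_le_of_le tendsto_const_nhds hsum
    (fun _ => zero_le) fun ν => ?_
  refine (measure_mono fun ω hω => ?_).trans (measure_union_le _ _)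
  by_contra hcon
  simp only [Set.mem_union, Set.mem_ofPred_eq, not_or, not_not] at hcon
  exact hω hcon

theorem TendstoZeroInProb.withProbTendingToOne_le {X : ∀ ν, Ω ν → ℝ≥0∞}
    (h : TendstoZeroInProb J X) {ε : ℝ≥0∞} (hε : 0 < ε) :
    WithProbTendingToOne J fun ν ω => X ν ω ≤ ε := by
  simpa [WithProbTendingToOne] using h ε hε

end ConvergenceInProbability

/-! ### Zeros and linearization of approximately linear maps. -/

namespace GEE

variable {d : ℕ}

/-- Links the entrywise Jacobian of the assumptions to the derivative used by the mean value
inequality. Expanding in the standard basis suffices; differentiability plays no role, since the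
entries are defined through `fderiv`. -/
theorem toEuclideanCLM_jacobian (F : EuclideanSpace ℝ (Fin d) → EuclideanSpace ℝ (Fin d))
    (β : EuclideanSpace ℝ (Fin d)) :
    Matrix.toEuclideanCLM (n := Fin d) (𝕜 := ℝ) (jacobian F β) = fderiv ℝ F β := by
  ext v j
  have hv : v = ∑ k, v k • EuclideanSpace.single k (1 : ℝ) := by
    ext i; simp [Pi.single_apply]
  conv_rhs => rw [hv]
  simp [jacobian, Matrix.mulVec, dotProduct, mul_comm]

/-- A map whose negative Jacobian is uniformly close to `D₀` on a convex set is there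
approximately linear, with linear part `-D₀`. -/
theorem approximatesLinearOn_of_negJacobian
    {g : EuclideanSpace ℝ (Fin d) → EuclideanSpace ℝ (Fin d)} {D₀ : Matrix (Fin d) (Fin d) ℝ}
    {s : Set (EuclideanSpace ℝ (Fin d))} (hs : Convex ℝ s) {c : NNReal}
    (hg : ∀ β ∈ s, DifferentiableAt ℝ g β)
    (hc : ∀ β ∈ s, ‖Matrix.toEuclideanCLM (n := Fin d) (𝕜 := ℝ) (-jacobian g β - D₀)‖ ≤ c) :
    ApproximatesLinearOn g (-Matrix.toEuclideanCLM (n := Fin d) (𝕜 := ℝ) D₀) s c := by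
  intro x hx y hy
  refine hs.norm_image_sub_le_of_norm_hasFDerivWithin_le' (𝕜 := ℝ) (f' := fderiv ℝ g)
    (fun β hβ => (hg β hβ).hasFDerivAt.hasFDerivWithinAt) (fun β hβ => ?_) hy hx
  have h := hc β hβ
  rw [← norm_neg, ← map_neg, neg_sub, sub_neg_eq_add, map_add, toEuclideanCLM_jacobian] at h
  rwa [sub_neg_eq_add, add_comm]

/-- An approximately linear map with small value at the centre of a ball vanishes in the ball. -/
theorem exists_zero_of_approximatesLinearOn
    {g : EuclideanSpace ℝ (Fin d) → EuclideanSpace ℝ (Fin d)} {D₀ : Matrix (Fin d) (Fin d) ℝ}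
    (hD₀ : IsUnit D₀) {K c : NNReal}
    (hK : ‖Matrix.toEuclideanCLM (n := Fin d) (𝕜 := ℝ) D₀⁻¹‖ ≤ K)
    {β₀ : EuclideanSpace ℝ (Fin d)} {ρ : ℝ} (hρ : 0 ≤ ρ)
    (hg : ApproximatesLinearOn g (-Matrix.toEuclideanCLM (n := Fin d) (𝕜 := ℝ) D₀)
      (Metric.closedBall β₀ ρ) c)
    (hsmall : ‖g β₀‖ ≤ ((K : ℝ)⁻¹ - c) * ρ) :
    ∃ β ∈ Metric.closedBall β₀ ρ, g β = 0 := by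
  have hdet : IsUnit D₀.det := (Matrix.isUnit_iff_isUnit_det D₀).1 hD₀
  -- With the right inverse `-D₀⁻¹` of norm at most `K`, the image of the ball of radius `ρ`
  -- contains the ball of radius `(K⁻¹ - c) * ρ` about `g β₀`, hence `0`.
  let R : (-Matrix.toEuclideanCLM (n := Fin d) (𝕜 := ℝ) D₀).NonlinearRightInverse :=
    { toFun := fun y => -Matrix.toEuclideanCLM (n := Fin d) (𝕜 := ℝ) D₀⁻¹ y
      nnnorm := K
      bound' := fun y => by
        rw [norm_neg]
        exact ContinuousLinearMap.le_of_opNorm_le _ hK y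
      right_inv' := fun y => by
        rw [neg_apply, map_neg, neg_neg, ← mul_apply_eq_comp,
          ← map_mul, Matrix.mul_nonsing_inv _ hdet, map_one, one_apply_eq_self] }
  obtain ⟨β, hβ, h0⟩ := hg.surjOn_closedBall_of_nonlinearRightInverse R hρ subset_rfl
    (show (0 : EuclideanSpace ℝ (Fin d)) ∈ _ by
      rw [Metric.mem_closedBall, dist_zero_left]; exact hsmall)
  exact ⟨β, hβ, h0⟩

/-- Linearization at the centre of a zero of an approximately linear map. -/
theorem norm_sub_inv_le_of_approximatesLinearOn
    {g : EuclideanSpace ℝ (Fin d) → EuclideanSpace ℝ (Fin d)} {D₀ : Matrix (Fin d) (Fin d) ℝ}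
    (hD₀ : IsUnit D₀) {K c : NNReal}
    (hK : ‖Matrix.toEuclideanCLM (n := Fin d) (𝕜 := ℝ) D₀⁻¹‖ ≤ K)
    {s : Set (EuclideanSpace ℝ (Fin d))}
    (hg : ApproximatesLinearOn g (-Matrix.toEuclideanCLM (n := Fin d) (𝕜 := ℝ) D₀) s c)
    {β₀ β : EuclideanSpace ℝ (Fin d)} (hβ₀ : β₀ ∈ s) (hβ : β ∈ s) (h0 : g β = 0) :
    ‖β - β₀ - Matrix.toEuclideanCLM (n := Fin d) (𝕜 := ℝ) D₀⁻¹ (g β₀)‖ ≤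
      K * (c * ‖β - β₀‖) := by
  have hdet : IsUnit D₀.det := (Matrix.isUnit_iff_isUnit_det D₀).1 hD₀
  have h := hg β hβ β₀ hβ₀
  rw [h0, zero_sub] at h
  -- The error is `D₀⁻¹` applied to the remainder of the affine approximation between `β` and `β₀`.
  have hinv : β - β₀ - Matrix.toEuclideanCLM (n := Fin d) (𝕜 := ℝ) D₀⁻¹ (g β₀) =
      Matrix.toEuclideanCLM (n := Fin d) (𝕜 := ℝ) D₀⁻¹
        (-g β₀ - (-Matrix.toEuclideanCLM (n := Fin d) (𝕜 := ℝ) D₀) (β - β₀)) := by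
    rw [neg_apply, sub_neg_eq_add, map_add, map_neg,
      ← mul_apply_eq_comp, ← map_mul, Matrix.nonsing_inv_mul _ hdet, map_one,
      one_apply_eq_self]
    abel
  rw [hinv]
  exact ContinuousLinearMap.le_of_opNorm_le_of_le _ hK h

/-! ### Measurability of the estimating functions at a fixed parameter. -/

namespace SurveySequence

variable {Θ : Type*} [MeasurableSpace Θ] {m : ℕ} (S : SurveySequence Θ d m)

theorem measurable_score (ν : ℕ) (i : Fin (S.N ν)) (β : EuclideanSpace ℝ (Fin d)) :
    Measurable fun θ => score S.μ S.φ (S.R ν i) (S.x ν i) (S.y ν i θ) β := by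
  have hcont (M : Matrix (Fin d) (Fin m) ℝ) (v : EuclideanSpace ℝ (Fin m)) :
      Continuous fun y : EuclideanSpace ℝ (Fin m) =>
        (WithLp.toLp 2 (M.mulVec (y - v).ofLp) : EuclideanSpace ℝ (Fin d)) := by
    fun_prop
  exact (hcont _ _).measurable.comp (S.y_measurable ν i)

theorem measurable_census (ν : ℕ) (β : EuclideanSpace ℝ (Fin d)) :
    Measurable fun θ => S.census ν θ β :=
  (Finset.measurable_fun_sum _ fun i _ => S.measurable_score ν i β).const_smul (S.N ν : ℝ)⁻¹

theorem measurable_inclusionProb (ν : ℕ) (i : Fin (S.N ν)) :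
    Measurable fun θ => S.inclusionProb ν θ i :=
  (((S.design ν).measurable_coe (measurableSet_mem_finset i)).comp
    (S.z_measurable ν)).ennreal_toReal

/-- There are finitely many samples, so joint measurability follows from measurability in `θ` for
each fixed sample. -/
theorem measurable_wgee (ν : ℕ) (β : EuclideanSpace ℝ (Fin d)) :
    Measurable fun ω => S.wgee ν ω β := by
  refine measurable_from_prod_countable_left fun s => ?_
  exact (Finset.measurable_fun_sum s fun i _ =>
    (S.measurable_inclusionProb ν i).inv.smul (S.measurable_score ν i β)).const_smul (S.N ν : ℝ)⁻¹

end SurveySequence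

end GEE

/-! ### Asymptotics of the survey-weighted estimating function and its roots. -/

namespace GEE

namespace SurveySequence

variable {Θ : Type*} [MeasurableSpace Θ] {d m : ℕ} (S : SurveySequence Θ d m)

theorem tendsto_sqrt_sampleSize (hn : Tendsto S.n atTop atTop) :
    Tendsto (fun ν => Real.sqrt (S.n ν)) atTop atTop :=
  Real.tendsto_sqrt_atTop.comp (tendsto_natCast_atTop_atTop.comp hn)

/-- Lets full balls, which are convex, replace their intersections with a parameter set of arbitrary
shape. -/
theorem eventually_closedBall_subset (hn : Tendsto S.n atTop atTop)
    {W : Set (EuclideanSpace ℝ (Fin d))} {β₀ : EuclideanSpace ℝ (Fin d)} (hW : W ∈ 𝓝 β₀) (r : ℝ) :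
    ∀ᶠ ν in atTop, Metric.closedBall β₀ (r / Real.sqrt (S.n ν)) ⊆ W := by
  obtain ⟨δ, hδ, hδW⟩ := Metric.nhds_basis_closedBall.mem_iff.1 hW
  filter_upwards [((S.tendsto_sqrt_sampleSize hn).const_div_atTop r).eventually_le_const hδ]
    with ν hν
  exact (Metric.closedBall_subset_closedBall hν).trans hδW

/-- The joint central limit theorem for the survey-weighted estimating function at the true
parameter: model and design variability add up. -/
theorem tendstoInDistribution_sqrt_smul_wgee (P : Measure Θ) [IsProbabilityMeasure P]
    (β₀ : EuclideanSpace ℝ (Fin d)) {f : ℝ} (hf0 : 0 ≤ f)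
    (hf : Tendsto (fun ν => (S.n ν : ℝ) / (S.N ν : ℝ)) atTop (𝓝 f))
    {Sigβ : Matrix (Fin d) (Fin d) ℝ} (hSigβ : Sigβ.PosSemidef)
    (hG1 : TendstoInDistribution (fun ν θ => Real.sqrt (S.N ν) • S.census ν θ β₀) atTop id
      (fun _ => P) (multivariateGaussian 0 Sigβ))
    {Sigd : Matrix (Fin d) (Fin d) ℝ} (hSigd : Sigd.PosSemidef)
    (hG2 : ∀ᵐ θ ∂P, TendstoInDistribution
      (fun ν s => Real.sqrt (S.n ν) • (S.wgee ν (θ, s) β₀ - S.census ν θ β₀)) atTop id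
      (fun ν => S.designProb ν θ) (multivariateGaussian 0 Sigd)) :
    TendstoInDistribution (fun ν ω => Real.sqrt (S.n ν) • S.wgee ν ω β₀) atTop id
      (S.jointProb P) (multivariateGaussian 0 (Sigd + f • Sigβ)) := by
  -- Limit of `√n ḡ_N(β₀) = √(n/N) • √N ḡ_N(β₀)`; for `f = 0` it is the point mass at zero.
  let ρ := (multivariateGaussian 0 Sigβ).map fun x => Real.sqrt f • x
  have : IsProbabilityMeasure ρ := Measure.isProbabilityMeasure_map (by fun_prop)
  have hU : TendstoInDistribution (fun ν θ => Real.sqrt (S.n ν) • S.census ν θ β₀) atTop id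
      (fun _ => P) ρ := by
    have hc : Tendsto (fun ν => Real.sqrt ((S.n ν : ℝ) / (S.N ν : ℝ))) atTop (𝓝 (Real.sqrt f)) :=
      (Real.continuous_sqrt.tendsto f).comp hf
    have h := hG1.continuous_comp_prodMk_of_tendstoInMeasure_const
      (g := fun p : EuclideanSpace ℝ (Fin d) × ℝ => p.2 • p.1) (by fun_prop)
      (Y := fun ν (_ : Θ) => Real.sqrt ((S.n ν : ℝ) / (S.N ν : ℝ)))
      (tendstoInMeasure_of_tendsto_ae (fun _ => aestronglyMeasurable_const)
        (ae_of_all _ fun _ => hc)) (fun _ => aemeasurable_const)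
    have hfun : (fun ν θ => Real.sqrt (S.n ν) • S.census ν θ β₀) = fun ν θ =>
        Real.sqrt ((S.n ν : ℝ) / (S.N ν : ℝ)) • Real.sqrt (S.N ν) • S.census ν θ β₀ := by
      ext1 ν
      ext1 θ
      -- The square roots cancel only if `N ν ≠ 0`; for an empty population the census function is
      -- an empty sum, and both sides vanish.
      rcases Nat.eq_zero_or_pos (S.N ν) with h0 | hpos
      · simp [census, h0]
      · rw [smul_smul, Real.sqrt_div (Nat.cast_nonneg _), div_mul_cancel₀]
        exact (Real.sqrt_pos.2 (Nat.cast_pos.2 hpos)).ne'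
    rw [hfun]
    refine ⟨h.forall_aemeasurable, aemeasurable_id, ?_⟩
    have ht := h.tendsto
    simp only [id_eq] at ht
    simpa only [Measure.map_id] using ht
  have hT (ν : ℕ) : Measurable fun ω : Θ × Finset (Fin (S.N ν)) =>
      Real.sqrt (S.n ν) • (S.wgee ν ω β₀ - S.census ν ω.1 β₀) :=
    ((S.measurable_wgee ν β₀).sub ((S.measurable_census ν β₀).comp measurable_fst)).const_smul
      (Real.sqrt (S.n ν))
  have hsum := tendstoInDistribution_add_of_conditional
    (fun ν => (S.design ν).comap (S.z ν) (S.z_measurable ν))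
    (fun ν => (S.measurable_census ν β₀).const_smul (Real.sqrt (S.n ν))) hT hU hG2
  have hfun : (fun ν (ω : Θ × Finset (Fin (S.N ν))) => Real.sqrt (S.n ν) • S.wgee ν ω β₀) =
      fun ν ω => Real.sqrt (S.n ν) • S.census ν ω.1 β₀ +
        Real.sqrt (S.n ν) • (S.wgee ν ω β₀ - S.census ν ω.1 β₀) := by
    ext1 ν
    ext1 ω
    rw [← smul_add, add_sub_cancel]
  have hρ : ρ ∗ multivariateGaussian 0 Sigd = multivariateGaussian 0 (Sigd + f • Sigβ) := by
    rw [multivariateGaussian_map_smul_conv hSigβ hSigd, Real.sq_sqrt hf0]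
  rw [hfun]
  simp_rw [hρ] at hsum
  exact hsum

/-- With probability tending to one, the survey-weighted estimating function is approximately
linear on the balls of radius `r / √n` around the true parameter. -/
theorem withProbTendingToOne_approximatesLinearOn (P : Measure Θ)
    {B : Set (EuclideanSpace ℝ (Fin d))} {β₀ : EuclideanSpace ℝ (Fin d)} (hβ₀ : β₀ ∈ interior B)
    (hn : Tendsto S.n atTop atTop) {D₀ : Matrix (Fin d) (Fin d) ℝ} {r : ℝ}
    (hdiff : WithProbTendingToOne (S.jointProb P) fun ν ω =>
      ∀ β ∈ S.localBall B β₀ r ν, DifferentiableAt ℝ (S.wgee ν ω) β)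
    (hG3 : TendstoZeroInProb (S.jointProb P) fun ν ω =>
      ⨆ β ∈ S.localBall B β₀ r ν,
        ‖Matrix.toEuclideanCLM (n := Fin d) (𝕜 := ℝ) (S.negJacobian ν ω β - D₀)‖ₑ)
    {c : NNReal} (hc : 0 < c) :
    WithProbTendingToOne (S.jointProb P) fun ν ω =>
      ApproximatesLinearOn (S.wgee ν ω) (-Matrix.toEuclideanCLM (n := Fin d) (𝕜 := ℝ) D₀)
        (Metric.closedBall β₀ (r / Real.sqrt (S.n ν))) c := by
  refine (hdiff.and (hG3.withProbTendingToOne_le (ENNReal.coe_pos.2 hc))).mono ?_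
  filter_upwards [S.eventually_closedBall_subset hn (mem_interior_iff_mem_nhds.1 hβ₀) r,
    (S.tendsto_sqrt_sampleSize hn).eventually_gt_atTop 0] with ν hB hpos ω hω
  have hball : Metric.closedBall β₀ (r / Real.sqrt (S.n ν)) ⊆ S.localBall B β₀ r ν := by
    intro β hβ
    refine ⟨hB hβ, ?_⟩
    rw [Metric.mem_closedBall, dist_eq_norm, le_div_iff₀ hpos] at hβ
    linarith
  refine approximatesLinearOn_of_negJacobian (convex_closedBall _ _)
    (fun β hβ => hω.1 β (hball hβ)) fun β hβ => ?_
  have h := (le_iSup₂ (f := fun β (_ : β ∈ S.localBall B β₀ r ν) =>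
    ‖Matrix.toEuclideanCLM (n := Fin d) (𝕜 := ℝ) (S.negJacobian ν ω β - D₀)‖ₑ) β
      (hball hβ)).trans hω.2
  exact enorm_le_coe.1 h

/-- Locally unique survey-weighted GEE estimators are `√n`-consistent. -/
theorem boundedInProb_of_locally_unique (P : Measure Θ) [IsProbabilityMeasure P]
    {B : Set (EuclideanSpace ℝ (Fin d))} {β₀ : EuclideanSpace ℝ (Fin d)} (hβ₀ : β₀ ∈ interior B)
    (hn : Tendsto S.n atTop atTop) {D₀ : Matrix (Fin d) (Fin d) ℝ} (hD₀ : IsUnit D₀)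
    (hlin : ∀ r : ℝ, 0 < r → ∀ c : NNReal, 0 < c → WithProbTendingToOne (S.jointProb P) fun ν ω =>
      ApproximatesLinearOn (S.wgee ν ω) (-Matrix.toEuclideanCLM (n := Fin d) (𝕜 := ℝ) D₀)
        (Metric.closedBall β₀ (r / Real.sqrt (S.n ν))) c)
    {ρ : Measure (EuclideanSpace ℝ (Fin d))} [IsProbabilityMeasure ρ]
    (hclt : TendstoInDistribution (fun ν ω => Real.sqrt (S.n ν) • S.wgee ν ω β₀) atTop id
      (S.jointProb P) ρ)
    {βbar : ∀ ν, Θ × Finset (Fin (S.N ν)) → EuclideanSpace ℝ (Fin d)}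
    {V : Set (EuclideanSpace ℝ (Fin d))} (hV : V ∈ 𝓝 β₀)
    (huniq : WithProbTendingToOne (S.jointProb P) fun ν ω =>
      βbar ν ω ∈ V ∧ ∀ β ∈ V ∩ B, S.wgee ν ω β = 0 → β = βbar ν ω) :
    BoundedInProb (S.jointProb P) fun ν ω => Real.sqrt (S.n ν) * ‖βbar ν ω - β₀‖ := by
  intro ε hε
  obtain ⟨M, hM, hMε⟩ := hclt.eventually_measure_norm_ge_le (ENNReal.half_pos hε.ne')
  -- The added `1` keeps `K` positive even for `d = 0`, where the norm vanishes.
  let K : NNReal := ‖Matrix.toEuclideanCLM (n := Fin d) (𝕜 := ℝ) D₀⁻¹‖₊ + 1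
  have hK : ‖Matrix.toEuclideanCLM (n := Fin d) (𝕜 := ℝ) D₀⁻¹‖ ≤ K := by
    simp [K]
  have hKpos : 0 < K := by positivity
  have hKpos' : (0 : ℝ) < K := hKpos
  -- With `c = K⁻¹ / 2`, the radius `2 * K * M / √n` makes `(K⁻¹ - c) * radius = M / √n`, exactly
  -- the available bound on `‖g_n(β₀)‖`.
  refine ⟨2 * K * M, ?_⟩
  have hgood := ((hlin (2 * K * M) (by positivity) (K⁻¹ / 2) (by positivity)).and huniq)
  have hVB : V ∩ B ∈ 𝓝 β₀ := inter_mem hV (mem_interior_iff_mem_nhds.1 hβ₀)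
  filter_upwards [hMε, hgood.eventually_le_const (ENNReal.half_pos hε.ne'),
    S.eventually_closedBall_subset hn hVB (2 * K * M),
    (S.tendsto_sqrt_sampleSize hn).eventually_gt_atTop 0] with ν hM' hbad hsub hpos
  rw [← ENNReal.add_halves ε]
  refine (measure_mono fun ω hω => ?_).trans ((measure_union_le _ _).trans (add_le_add hM' hbad))
  by_contra hcon
  simp only [Set.mem_union, Set.mem_ofPred_eq, not_or, not_not, not_le] at hcon
  obtain ⟨hsmall, hlinω, -, huω⟩ := hcon
  rw [norm_smul, Real.norm_of_nonneg hpos.le] at hsmall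
  obtain ⟨β, hβ, h0⟩ := exists_zero_of_approximatesLinearOn hD₀ hK
    (div_nonneg (by positivity) hpos.le) hlinω (by
      have heq : ((K : ℝ)⁻¹ - ((K⁻¹ / 2 : NNReal) : ℝ)) * (2 * K * M / Real.sqrt (S.n ν)) =
          M / Real.sqrt (S.n ν) := by
        push_cast
        field_simp
        ring
      rw [heq, le_div_iff₀ hpos]
      linarith)
  rw [huω β (hsub hβ) h0, Metric.mem_closedBall, dist_eq_norm, le_div_iff₀ hpos] at hβ
  have hω' : 2 * K * M < Real.sqrt (S.n ν) * ‖βbar ν ω - β₀‖ := hω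
  linarith

/-- Asymptotic linearity of `√n`-consistent survey-weighted GEE estimators. -/
theorem tendsto_measure_linearization_error (P : Measure Θ) [IsProbabilityMeasure P]
    {β₀ : EuclideanSpace ℝ (Fin d)}
    (hn : Tendsto S.n atTop atTop) {D₀ : Matrix (Fin d) (Fin d) ℝ} (hD₀ : IsUnit D₀)
    (hlin : ∀ r : ℝ, 0 < r → ∀ c : NNReal, 0 < c → WithProbTendingToOne (S.jointProb P) fun ν ω =>
      ApproximatesLinearOn (S.wgee ν ω) (-Matrix.toEuclideanCLM (n := Fin d) (𝕜 := ℝ) D₀)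
        (Metric.closedBall β₀ (r / Real.sqrt (S.n ν))) c)
    {βbar : ∀ ν, Θ × Finset (Fin (S.N ν)) → EuclideanSpace ℝ (Fin d)}
    (hroot : WithProbTendingToOne (S.jointProb P) fun ν ω => S.wgee ν ω (βbar ν ω) = 0)
    (hbdd : BoundedInProb (S.jointProb P) fun ν ω => Real.sqrt (S.n ν) * ‖βbar ν ω - β₀‖)
    {ε : ℝ} (hε : 0 < ε) :
    Tendsto (fun ν => S.jointProb P ν {ω | ε ≤ ‖Real.sqrt (S.n ν) • (βbar ν ω - β₀) -
      Matrix.toEuclideanCLM (n := Fin d) (𝕜 := ℝ) D₀⁻¹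
        (Real.sqrt (S.n ν) • S.wgee ν ω β₀)‖}) atTop (𝓝 0) := by
  rw [ENNReal.tendsto_nhds_zero]
  intro η hη
  obtain ⟨r₀, hr₀⟩ := hbdd (η / 2) (ENNReal.half_pos hη.ne')
  let r : ℝ := max r₀ 1
  have hr : 0 < r := lt_max_of_lt_right one_pos
  let K : NNReal := ‖Matrix.toEuclideanCLM (n := Fin d) (𝕜 := ℝ) D₀⁻¹‖₊ + 1
  have hK : ‖Matrix.toEuclideanCLM (n := Fin d) (𝕜 := ℝ) D₀⁻¹‖ ≤ K := by
    simp [K]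
  have hKpos : (0 : ℝ) < K := by positivity
  -- Chosen so that the scaled linearization error, at most `K * c * r`, equals `ε / 2`; an error of
  -- at least `ε` then contradicts the good event.
  let c : NNReal := ⟨ε / (2 * K * r), by positivity⟩
  have hc : 0 < c := show 0 < ε / (2 * K * r) by positivity
  have hgood := (hlin r hr c hc).and hroot
  filter_upwards [hr₀, hgood.eventually_le_const (ENNReal.half_pos hη.ne'),
    (S.tendsto_sqrt_sampleSize hn).eventually_gt_atTop 0] with ν hr₀' hbad hpos
  rw [← ENNReal.add_halves η]
  refine (measure_mono fun ω hω => ?_).trans ((measure_union_le _ _).trans (add_le_add hr₀' hbad))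
  by_contra hcon
  simp only [Set.mem_union, Set.mem_ofPred_eq, not_or, not_not, not_lt] at hcon
  obtain ⟨hle, hlinω, h0⟩ := hcon
  have hle' : Real.sqrt (S.n ν) * ‖βbar ν ω - β₀‖ ≤ r := hle.trans (le_max_left _ _)
  have hmem : βbar ν ω ∈ Metric.closedBall β₀ (r / Real.sqrt (S.n ν)) := by
    rw [Metric.mem_closedBall, dist_eq_norm, le_div_iff₀ hpos]
    linarith
  have h := norm_sub_inv_le_of_approximatesLinearOn hD₀ hK hlinω
    (Metric.mem_closedBall_self (div_nonneg hr.le hpos.le)) hmem h0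
  have hω' : ε ≤ ‖Real.sqrt (S.n ν) • (βbar ν ω - β₀) -
      Matrix.toEuclideanCLM (n := Fin d) (𝕜 := ℝ) D₀⁻¹
        (Real.sqrt (S.n ν) • S.wgee ν ω β₀)‖ := hω
  rw [map_smul, ← smul_sub, norm_smul, Real.norm_of_nonneg hpos.le] at hω'
  have hcval : (c : ℝ) = ε / (2 * K * r) := rfl
  have hbound : ε ≤ ε / 2 := by
    calc ε ≤ Real.sqrt (S.n ν) * (K * (c * ‖βbar ν ω - β₀‖)) :=
          hω'.trans (mul_le_mul_of_nonneg_left h hpos.le)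
      _ = K * c * (Real.sqrt (S.n ν) * ‖βbar ν ω - β₀‖) := by ring
      _ ≤ K * c * r := mul_le_mul_of_nonneg_left hle' (by positivity)
      _ = ε / 2 := by rw [hcval]; field_simp
  linarith

end SurveySequence

end GEE

/-! ### Asymptotic normality of the estimators. -/

theorem mainTheorem4 {Θ : Type*} [MeasurableSpace Θ] {d m : ℕ}
    (S : GEE.SurveySequence Θ d m)
    -- the model probability, the parameter set and the true value of the parameter
    (P : Measure Θ) [IsProbabilityMeasure P]
    (B : Set (EuclideanSpace ℝ (Fin d))) (β₀ : EuclideanSpace ℝ (Fin d)) (hβ₀ : β₀ ∈ interior B)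
    -- sampling fraction
    (hn : Tendsto S.n atTop atTop)
    (f : ℝ) (hf0 : 0 ≤ f) (hf1 : f < 1)
    (hf : Tendsto (fun ν => (S.n ν : ℝ) / (S.N ν : ℝ)) atTop (𝓝 f))
    -- model central limit theorem for the census estimating function
    (Sigβ : Matrix (Fin d) (Fin d) ℝ) (hSigβ : Sigβ.PosDef)
    (hG1 : TendstoInDistribution (fun ν θ => Real.sqrt (S.N ν) • S.census ν θ β₀) atTop id
      (fun _ => P) (multivariateGaussian 0 Sigβ))
    -- design central limit theorem, given almost every sequence of finite populations
    (Sigd : Matrix (Fin d) (Fin d) ℝ) (hSigd : Sigd.PosDef)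
    (hG2 : ∀ᵐ θ ∂P, TendstoInDistribution
      (fun ν s => Real.sqrt (S.n ν) • (S.wgee ν (θ, s) β₀ - S.census ν θ β₀)) atTop id
      (fun ν => S.designProb ν θ) (multivariateGaussian 0 Sigd))
    -- uniform convergence of the negative Jacobian on the shrinking balls
    (D₀ : Matrix (Fin d) (Fin d) ℝ) (hD₀ : IsUnit D₀)
    (hdiff : ∀ r : ℝ, 0 < r → WithProbTendingToOne (S.jointProb P) fun ν ω =>
      ∀ β ∈ S.localBall B β₀ r ν, DifferentiableAt ℝ (S.wgee ν ω) β)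
    (hG3 : ∀ r : ℝ, 0 < r → TendstoZeroInProb (S.jointProb P) fun ν ω =>
      ⨆ β ∈ S.localBall B β₀ r ν,
        ‖Matrix.toEuclideanCLM (n := Fin d) (𝕜 := ℝ) (S.negJacobian ν ω β - D₀)‖ₑ)
    -- the survey-weighted GEE estimators
    (βbar : ∀ ν, Θ × Finset (Fin (S.N ν)) → EuclideanSpace ℝ (Fin d))
    (hβbar : S.IsEstimator P B β₀ βbar) :
    TendstoInDistribution (fun ν ω => Real.sqrt (S.n ν) • (βbar ν ω - β₀)) atTop id
      (S.jointProb P)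
      (multivariateGaussian 0 (D₀⁻¹ * (Sigd + f • Sigβ) * (D₀⁻¹).transpose)) := by
  have hlin : ∀ r : ℝ, 0 < r → ∀ c : NNReal, 0 < c → _ := fun r hr c hc =>
    S.withProbTendingToOne_approximatesLinearOn P hβ₀ hn (hdiff r hr) (hG3 r hr) hc
  have hclt := S.tendstoInDistribution_sqrt_smul_wgee P β₀ hf0 hf hSigβ.posSemidef hG1
    hSigd.posSemidef hG2
  have hbdd : BoundedInProb (S.jointProb P)
      (fun ν ω => Real.sqrt (S.n ν) * ‖βbar ν ω - β₀‖) := by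
    rcases hβbar.selection with h | ⟨V, hV, huniq⟩
    · exact h
    · exact S.boundedInProb_of_locally_unique P hβ₀ hn hD₀ hlin hclt hV huniq
  have hroot : WithProbTendingToOne (S.jointProb P) fun ν ω => S.wgee ν ω (βbar ν ω) = 0 :=
    hβbar.root.mono (Eventually.of_forall fun _ _ h => h.2)
  have hSig : (Sigd + f • Sigβ).PosSemidef := hSigd.posSemidef.add (hSigβ.posSemidef.smul hf0)
  have hlim : TendstoInDistribution (fun ν ω => Matrix.toEuclideanCLM (n := Fin d) (𝕜 := ℝ) D₀⁻¹
      (Real.sqrt (S.n ν) • S.wgee ν ω β₀)) atTop id (S.jointProb P)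
      (multivariateGaussian 0 (D₀⁻¹ * (Sigd + f • Sigβ) * (D₀⁻¹).transpose)) := by
    have h := hclt.continuous_comp
      (Matrix.toEuclideanCLM (n := Fin d) (𝕜 := ℝ) D₀⁻¹).continuous
    refine ⟨h.forall_aemeasurable, aemeasurable_id, ?_⟩
    have ht := h.tendsto
    simp_rw [Function.comp_id, multivariateGaussian_map_toEuclideanCLM hSig] at ht
    simp_rw [Measure.map_id]
    exact ht
  exact hlim.of_norm_sub_tendsto_zero
    (fun ν => ((hβbar.aemeasurable ν).sub_const β₀).const_smul (Real.sqrt (S.n ν)))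
    fun ε hε => S.tendsto_measure_linearization_error P hn hD₀ hlin hroot hbdd hε
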